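/- All graphs are finite, simple and undirected. For a graph $G=(V,E)$ let $\alpha(G)$ be the maximum size of an independent set and $\mu(G)$ the maximum size of a matching; $G$ is a König–Egerváry graph if $\alpha(G)+\mu(G)=|V|$. For $A\subseteq V$ let $N(A)$ be the set of vertices having a neighbor in $A$. Let $\mathrm{core}(G)$ be the intersection of all maximum independent sets of $G$, and let $\ker(G)$ be the intersection of all critical independent sets of $G$, i.e. of all independent sets $A$ with $|A|-|N(A)|=\max_{B\subseteq V}(|B|-|N(B)|)$. Put $\xi(G)=|\mathrm{core}(G)|$ and $\varepsilon(G)=|\ker(G)|$. An edge $e$ is $\mu$-critical if $\mu(G-e)<\mu(G)$. Let $c(G)$ be the number of $\mu$-critical edges of $G$ that join a vertex of $\mathrm{core}(G)$ to a vertex of $N(\mathrm{core}(G))$, and let $\varrho_e(G)$ be the number of edges $e$ such that $G-e$ is a König–Egerváry graph. **Theorem.** (a) If $G$ is a König–Egerváry graph, then $c(G)=|E|-\varrho_e(G)$. If moreover $\xi(G)-\varepsilon(G)\ge 2$, then either $c(G)=\xi(G)-\varepsilon(G)$ or $c(G)\in\{0,\dots,\xi(G)-\varepsilon(G)-2\}$;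 in particular $c(G)\neq \xi(G)-\varepsilon(G)-1$. (b) Conversely, for every integer $d\ge 2$ and every $t\in\{0,\dots,d-2\}\cup\{d\}$ there is a König–Egerváry graph $G$ with $\xi(G)-\varepsilon(G)=d$ and $c(G)=t$. (c) For integers $p\ge q\ge 2$ let $G_p^q$ be the graph with the $2p$ vertices $a_1,\dots,a_p,b_1,\dots,b_p$ in which $\{a_1,\dots,a_p\}$ is a clique, $\{b_1,\dots,b_p\}$ is independent, and $a_ib_j$ is an edge if and only if $j=i$ or $j\le q$. Then $G_p^q$ is a König–Egerváry graph with $\xi(G_p^q)=p$, $\varepsilon(G_p^q)=0$ and $c(G_p^q)=p-q$. Hence for $d\ge2$ every value $t\in\{0,\dots,d-2\}$ in (b) is attained by $G_d^{\,d-t}$. -/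

import Mathlib

namespace SimpleGraph

section

variable {V : Type*}

/-- The neighborhood `N(A)`: all vertices adjacent to some vertex of `A`. -/
def nbhd (G : SimpleGraph V) (A : Set V) : Set V :=
  {v | ∃ a ∈ A, G.Adj a v}

/-- The set `(A, B)` of all edges of `G` joining a vertex of `A` to a vertex of `B`. -/
def edgesBetween (G : SimpleGraph V) (A B : Set V) : Set (Sym2 V) :=
  {e | ∃ a ∈ A, ∃ b ∈ B, G.Adj a b ∧ e = s(a, b)}

/-- The matching number `μ(G)`: the largest number of edges of a matching of `G`. -/
noncomputable def matchingNum (G : SimpleGraph V) : ℕ :=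
  sSup {n | ∃ M : G.Subgraph, M.IsMatching ∧ M.edgeSet.ncard = n}

/-- `G` is a König–Egerváry graph if `α(G) + μ(G) = |V(G)|`. -/
def IsKonigEgervary (G : SimpleGraph V) : Prop :=
  G.indepNum + G.matchingNum = Nat.card V

/-- `core(G)`: the intersection of all maximum independent sets of `G`. -/
def core [Finite V] (G : SimpleGraph V) : Set V :=
  {v | ∀ S : Finset V, G.IsMaximumIndepSet S → v ∈ S}

/-- `ξ(G) = |core(G)|`. -/
noncomputable def xi [Finite V] (G : SimpleGraph V) : ℕ :=
  G.core.ncard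

/-- The difference `d(A) = |A| - |N(A)|` of a set of vertices, an integer. -/
noncomputable def setDifference (G : SimpleGraph V) (A : Set V) : ℤ :=
  (A.ncard : ℤ) - ((G.nbhd A).ncard : ℤ)

/-- `A` is a critical independent set: it is independent and its difference attains
the critical difference `d(G) = max {d(B) : B ⊆ V(G)}`. -/
def IsCriticalIndepSet (G : SimpleGraph V) (A : Set V) : Prop :=
  G.IsIndepSet A ∧ ∀ B : Set V, G.setDifference B ≤ G.setDifference A

/-- `ker(G)`: the intersection of all critical independent sets of `G`. -/
def criticalKer (G : SimpleGraph V) : Set V :=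
  {v | ∀ A : Set V, G.IsCriticalIndepSet A → v ∈ A}

/-- `ε(G) = |ker(G)|`. -/
noncomputable def eps (G : SimpleGraph V) : ℕ :=
  G.criticalKer.ncard

/-- The edge `e` of `G` is `μ`-critical if `μ(G - e) < μ(G)`. -/
def IsMuCriticalEdge (G : SimpleGraph V) (e : Sym2 V) : Prop :=
  e ∈ G.edgeSet ∧ (G.deleteEdges {e}).matchingNum < G.matchingNum

/-- The number of `μ`-critical edges of `G` that belong to `(core(G), N(core(G)))`. -/
noncomputable def numMuCriticalCoreEdges [Finite V] (G : SimpleGraph V) : ℕ :=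
  {e | e ∈ G.edgesBetween G.core (G.nbhd G.core) ∧ G.IsMuCriticalEdge e}.ncard

/-- `ϱₑ(G)`: the number of edges `e` of `G` such that `G - e` is a König–Egerváry graph. -/
noncomputable def rhoE (G : SimpleGraph V) : ℕ :=
  {e | e ∈ G.edgeSet ∧ (G.deleteEdges {e}).IsKonigEgervary}.ncard

end

/-- The graph `G_p^q` on the vertices `a_1, …, a_p` (here `Sum.inl 0, …, Sum.inl (p - 1)`) and
`b_1, …, b_p` (here `Sum.inr 0, …, Sum.inr (p - 1)`): the `a_i` form a clique, the `b_j` are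
independent, and `a_i b_j` is an edge exactly when `j = i` or `j ≤ q`. -/
def cliqueFamily (p q : ℕ) : SimpleGraph (Fin p ⊕ Fin p) where
  Adj
    | Sum.inl i, Sum.inl j => i ≠ j
    | Sum.inl i, Sum.inr j => j = i ∨ j.val < q
    | Sum.inr j, Sum.inl i => j = i ∨ j.val < q
    | Sum.inr _, Sum.inr _ => False
  symm := ⟨by
    rintro (i | i) (j | j) h
    · exact Ne.symm h
    · exact h
    · exact h
    · exact h⟩
  loopless := ⟨by
    rintro (i | i) h
    · exact h rfl
    · exact h⟩

end SimpleGraph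

/-!
In a König–Egerváry graph `G` fix a maximum independent set `S`. The maximum matchings of `G` are
exactly the matchings of `Sᶜ` into `S`, encoded here by maps `f` that are injective on `Sᶜ` and send
each `y ∉ S` to a neighbor in `S` (`IsMatchingInto`). An edge between `S` and `Sᶜ` is `μ`-critical
if and only if all these maps use it (`isMuCriticalEdge_iff`).

*The count and `ϱₑ`.* Deleting an edge raises `α` by at most one and lowers `μ` by at most one, so
`G - e` fails to be König–Egerváry exactly when `e` is `μ`-critical and `α` does not change. If an
endpoint of `e` lies in the core, then `α` cannot grow. If neither endpoint does, then each endpoint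
lies in some maximum independent set, and Hall's theorem for `Sᶜ` and `S` in `G - e` lets one
combine the two sets into an independent set of `G - e` with more than `α(G)` vertices
(`IsMuCriticalEdge.indepNum_lt`).

*The missing value.* The critical independent sets are closed under intersection and include the
maximum independent sets, so both `core(G)` and `ker(G)` are critical. Hence every matching of `Sᶜ`
into `S` restricts to a bijection from the fixed set `Y = N(core) \ N(ker)` onto `core \ ker`, both
of size `k = ξ(G) - ε(G)` (`IsMatchingInto.image_compl_diff_nbhd`). As no `μ`-critical edge meets
the kernel (`IsMuCriticalEdge.notMem_criticalKer`, again by Hall's theorem), the count is the number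
of `y ∈ Y` that have the same image under all matchings. Two bijections between the same finite
sets cannot differ at exactly one point, so the count is not `k - 1`
(`numMuCriticalCoreEdges_eq_or_le`).

*Realization.* In `G_p^q` the critical edges at the core are the edges at the leaves `b_j`, `j > q`,
because the matching edges with smaller indices can be permuted. The value `t = d` is attained by
`G_{d+1}^1`, where the core consists of the leaves only.
-/

namespace SimpleGraph

variable {V : Type*} {G : SimpleGraph V}

/-- The map `f` matches the complement of `S` into `S`: it is injective on `Sᶜ` and sends every
vertex outside `S` to a neighbor in `S`. The values of `f` on `S` are irrelevant. -/
structure IsMatchingInto (G : SimpleGraph V) (S : Set V) (f : V → V) : Prop where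
  injOn : Set.InjOn f Sᶜ
  mem : ∀ y ∉ S, f y ∈ S
  adj : ∀ y ∉ S, G.Adj y (f y)

lemma IsIndepSet.not_adj {S : Set V} (hS : G.IsIndepSet S) {x y : V} (hx : x ∈ S) (hy : y ∈ S) :
    ¬ G.Adj x y :=
  fun h => hS hx hy h.ne h

lemma isIndepSet_of_forall_not_adj {S : Set V} (h : ∀ x ∈ S, ∀ y ∈ S, ¬ G.Adj x y) :
    G.IsIndepSet S :=
  fun x hx y hy _ => h x hx y hy

/-! ### Matchings and independent sets -/

lemma IsIndepSet.deleteEdges {S : Set V} (hS : G.IsIndepSet S) (s : Set (Sym2 V)) :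
    (G.deleteEdges s).IsIndepSet S :=
  fun _ hx _ hy hne h => hS hx hy hne (deleteEdges_le s h)

/-- Two edges of a matching that share a vertex coincide. -/
lemma Subgraph.IsMatching.edge_eq {M : G.Subgraph} (hM : M.IsMatching) {e e' : Sym2 V}
    (he : e ∈ M.edgeSet) (he' : e' ∈ M.edgeSet) {x : V} (hx : x ∈ e) (hx' : x ∈ e') : e = e' := by
  obtain ⟨y, rfl⟩ := hx
  obtain ⟨z, rfl⟩ := hx'
  rw [hM.eq_of_adj_left (Subgraph.mem_edgeSet.1 he) (Subgraph.mem_edgeSet.1 he')]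

/-- The edges of a matching can be represented by distinct vertices outside a given independent
set. -/
lemma IsIndepSet.exists_injOn_edgeSet {S : Set V} (hS : G.IsIndepSet S) {M : G.Subgraph}
    (hM : M.IsMatching) :
    ∃ g : Sym2 V → V, Set.InjOn g M.edgeSet ∧ ∀ e ∈ M.edgeSet, g e ∈ e ∧ g e ∉ S := by
  have h : ∀ e : Sym2 V, ∃ x, e ∈ M.edgeSet → x ∈ e ∧ x ∉ S := by
    intro e
    induction e with
    | _ x y =>
      by_cases hx : x ∈ S
      · refine ⟨y, fun h => ⟨Sym2.mem_mk_right x y, fun hy => ?_⟩⟩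
        exact hS.not_adj hx hy (M.adj_sub h)
      · exact ⟨x, fun _ => ⟨Sym2.mem_mk_left x y, hx⟩⟩
  choose g hg using h
  refine ⟨g, fun e he e' he' h => ?_, hg⟩
  exact hM.edge_eq he he' (hg e he).1 (h ▸ (hg e' he').1)

lemma exists_isIndepSet_ncard_eq (G : SimpleGraph V) :
    ∃ S : Set V, G.IsIndepSet S ∧ S.ncard = G.indepNum := by
  obtain ⟨s, hs⟩ := G.exists_isNIndepSet_indepNum
  exact ⟨s, hs.1, by rw [Set.ncard_coe_finset, hs.2]⟩

section Finite

variable [Finite V]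

lemma bddAbove_matching (G : SimpleGraph V) :
    BddAbove {n | ∃ M : G.Subgraph, M.IsMatching ∧ M.edgeSet.ncard = n} := by
  refine ⟨Nat.card (Sym2 V), ?_⟩
  rintro n ⟨M, -, rfl⟩
  exact Set.ncard_le_card _

lemma exists_isMatching_ncard_eq_matchingNum (G : SimpleGraph V) :
    ∃ M : G.Subgraph, M.IsMatching ∧ M.edgeSet.ncard = G.matchingNum := by
  refine Nat.sSup_mem (s := {n | ∃ M : G.Subgraph, M.IsMatching ∧ M.edgeSet.ncard = n})
    ⟨0, ⊥, ?_, ?_⟩ (bddAbove_matching G)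
  · intro v hv
    exact hv.elim
  · simp

lemma ncard_le_matchingNum {C : Set V} {f : V → V} (hf : Set.InjOn f C)
    (hC : ∀ c ∈ C, f c ∉ C) (hadj : ∀ c ∈ C, G.Adj c (f c)) : C.ncard ≤ G.matchingNum := by
  let M : G.Subgraph :=
    { verts := C ∪ f '' C
      Adj := fun x y => (x ∈ C ∧ f x = y) ∨ (y ∈ C ∧ f y = x)
      adj_sub := by
        rintro x y (⟨hx, rfl⟩ | ⟨hy, rfl⟩)
        · exact hadj x hx
        · exact (hadj y hy).symm
      edge_vert := by
        rintro x y (⟨hx, rfl⟩ | ⟨hy, rfl⟩)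
        · exact Or.inl hx
        · exact Or.inr ⟨y, hy, rfl⟩
      symm := ⟨fun x y h => h.symm⟩ }
  have hM : M.IsMatching := by
    rintro v (hv | ⟨c, hc, rfl⟩)
    · refine ⟨f v, Or.inl ⟨hv, rfl⟩, ?_⟩
      rintro y (⟨-, h⟩ | ⟨hy, h⟩)
      · exact h.symm
      · exact absurd (h ▸ hv) (hC y hy)
    · refine ⟨c, Or.inr ⟨hc, rfl⟩, ?_⟩
      rintro y (⟨h, -⟩ | ⟨hy, h⟩)
      · exact absurd h (hC c hc)
      · exact hf hy hc h
  have hinj : Set.InjOn (fun c => s(c, f c)) C := by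
    intro c hc c' hc' h
    rcases Sym2.eq_iff.1 h with ⟨h, -⟩ | ⟨h, -⟩
    · exact h
    · exact absurd (h ▸ hc) (hC c' hc')
  calc C.ncard = ((fun c => s(c, f c)) '' C).ncard := (hinj.ncard_image).symm
    _ ≤ M.edgeSet.ncard := by
      refine Set.ncard_le_ncard ?_
      rintro _ ⟨c, hc, rfl⟩
      exact Or.inl ⟨hc, rfl⟩
    _ ≤ G.matchingNum := le_csSup (bddAbove_matching G) ⟨M, hM, rfl⟩

lemma IsIndepSet.ncard_le_indepNum {S : Set V} (hS : G.IsIndepSet S) :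
    S.ncard ≤ G.indepNum := by
  have := Fintype.ofFinite V
  classical
  rw [Set.ncard_eq_toFinset_card']
  exact IsIndepSet.card_le_indepNum (by simpa using hS)

lemma mem_core_iff {v : V} :
    v ∈ G.core ↔ ∀ S : Set V, G.IsIndepSet S → S.ncard = G.indepNum → v ∈ S := by
  have := Fintype.ofFinite V
  classical
  constructor
  · intro h S hS hc
    have : G.IsMaximumIndepSet S.toFinset := by
      refine ⟨by simpa using hS, fun t ht => ?_⟩
      rw [← Set.ncard_eq_toFinset_card', hc]
      exact ht.card_le_indepNum
    simpa using h _ this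
  · intro h S hS
    have := h S hS.1 (by rw [Set.ncard_coe_finset, maximumIndepSet_card_eq_indepNum S hS])
    simpa using this

lemma IsIndepSet.ncard_add_matchingNum_le {S : Set V} (hS : G.IsIndepSet S) :
    S.ncard + G.matchingNum ≤ Nat.card V := by
  obtain ⟨M, hM, hμ⟩ := G.exists_isMatching_ncard_eq_matchingNum
  obtain ⟨g, hg, hgS⟩ := hS.exists_injOn_edgeSet hM
  have := Set.ncard_le_ncard_of_injOn (t := Sᶜ) g (fun e he => (hgS e he).2) hg
  have := Set.ncard_add_ncard_compl S
  omega

lemma indepNum_add_matchingNum_le (G : SimpleGraph V) :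
    G.indepNum + G.matchingNum ≤ Nat.card V := by
  obtain ⟨S, hS, hc⟩ := G.exists_isIndepSet_ncard_eq
  exact hc ▸ hS.ncard_add_matchingNum_le

/-- If the bound `|S| + μ(G) ≤ |V|` is attained by the independent set `S`, then a maximum
matching matches `Sᶜ` into `S`. -/
lemma IsIndepSet.exists_isMatchingInto {S : Set V} (hS : G.IsIndepSet S)
    (h : Nat.card V ≤ S.ncard + G.matchingNum) : ∃ f, G.IsMatchingInto S f := by
  obtain ⟨M, hM, hμ⟩ := G.exists_isMatching_ncard_eq_matchingNum
  obtain ⟨g, hg, hgS⟩ := hS.exists_injOn_edgeSet hM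
  have himg : g '' M.edgeSet = Sᶜ := by
    refine Set.eq_of_subset_of_ncard_le ?_ ?_
    · rintro _ ⟨e, he, rfl⟩
      exact (hgS e he).2
    · rw [hg.ncard_image]
      have := Set.ncard_add_ncard_compl S
      omega
  have key : ∀ y, ∃ x, y ∉ S → M.Adj y x ∧ x ∈ S := by
    intro y
    by_cases hy : y ∈ S
    · exact ⟨y, fun h => absurd hy h⟩
    obtain ⟨e, he, rfl⟩ : y ∈ g '' M.edgeSet := himg ▸ hy
    obtain ⟨x, hx⟩ := (hgS e he).1
    have hadj : M.Adj (g e) x := by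
      rw [← Subgraph.mem_edgeSet, ← hx]
      exact he
    refine ⟨x, fun _ => ⟨hadj, ?_⟩⟩
    by_contra hxS
    obtain ⟨e', he', rfl⟩ : x ∈ g '' M.edgeSet := himg ▸ hxS
    have : e = e' := hM.edge_eq he he' (hx ▸ Sym2.mem_mk_right _ _) (hgS e' he').1
    exact hadj.ne (this ▸ rfl)
  choose f hf using key
  refine ⟨f, fun y hy y' hy' h => ?_, fun y hy => (hf y hy).2, fun y hy => M.adj_sub (hf y hy).1⟩
  exact hM.eq_of_adj_right (hf y hy).1 (h ▸ (hf y' hy').1)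

lemma IsMatchingInto.ncard_compl_le {S : Set V} {f : V → V} (hf : G.IsMatchingInto S f) :
    Sᶜ.ncard ≤ G.matchingNum :=
  ncard_le_matchingNum hf.injOn (fun y hy => not_not.2 (hf.mem y hy)) hf.adj

lemma IsMatchingInto.ncard_eq {S : Set V} {f : V → V} (hf : G.IsMatchingInto S f)
    (hS : G.IsIndepSet S) : S.ncard = G.indepNum ∧ Sᶜ.ncard = G.matchingNum := by
  have := hf.ncard_compl_le
  have := hS.ncard_le_indepNum
  have := Set.ncard_add_ncard_compl S
  have := G.indepNum_add_matchingNum_le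
  omega

lemma IsMatchingInto.isKonigEgervary {S : Set V} {f : V → V} (hf : G.IsMatchingInto S f)
    (hS : G.IsIndepSet S) : G.IsKonigEgervary := by
  have := hf.ncard_eq hS
  have := Set.ncard_add_ncard_compl S
  unfold IsKonigEgervary
  omega

lemma IsKonigEgervary.exists_isMatchingInto (hG : G.IsKonigEgervary) {S : Set V}
    (hS : G.IsIndepSet S) (hc : S.ncard = G.indepNum) : ∃ f, G.IsMatchingInto S f :=
  hS.exists_isMatchingInto (by rw [hc, hG])

/-- A maximum independent set `T` meets every edge of a matching of `Sᶜ` into `S`: otherwise the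
vertices outside `T` would outnumber the matching edges. -/
lemma IsMatchingInto.mem_or_mem {S T : Set V} {f : V → V} (hf : G.IsMatchingInto S f)
    (hT : G.IsIndepSet T) (hST : T.ncard = S.ncard) {y : V} (hy : y ∉ S) :
    y ∈ T ∨ f y ∈ T := by
  classical
  by_contra! h
  let p : V → V := fun z => if z ∈ T then f z else z
  have hp : Set.InjOn p Sᶜ := by
    intro z hz w hw hzw
    simp only [p] at hzw
    split_ifs at hzw
    · exact hf.injOn hz hw hzw
    · exact absurd (hzw ▸ hf.mem z hz) hw
    · exact absurd (hzw ▸ hf.mem w hw) hz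
    · exact hzw
  have himg : p '' Sᶜ = Tᶜ := by
    refine Set.eq_of_subset_of_ncard_le ?_ ?_
    · rintro _ ⟨z, hz, rfl⟩
      by_cases hzT : z ∈ T
      · simp only [p, hzT, if_true]
        exact fun h' => hT.not_adj hzT h' (hf.adj z hz)
      · simpa only [p, hzT, if_false]
    · rw [hp.ncard_image]
      have := Set.ncard_add_ncard_compl S
      have := Set.ncard_add_ncard_compl T
      omega
  obtain ⟨z, hz, hzy⟩ : f y ∈ p '' Sᶜ := himg ▸ h.2
  simp only [p] at hzy
  split_ifs at hzy with hzT
  · exact h.1 (hf.injOn hz hy hzy ▸ hzT)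
  · exact hz (hzy ▸ hf.mem y hy)

/-- Hall's theorem: if `Sᶜ` is too large to be matched into `S`, some subset of it has too few
neighbors in `S`. -/
lemma exists_ncard_nbhd_inter_lt {H : SimpleGraph V} {S : Set V}
    (h : H.matchingNum < Sᶜ.ncard) :
    ∃ A ⊆ Sᶜ, (H.nbhd A ∩ S).ncard < A.ncard := by
  have := Fintype.ofFinite V
  classical
  by_contra! hA
  let t : ↥(Sᶜ) → Finset V := fun a => Finset.univ.filter fun b => b ∈ S ∧ H.Adj a b
  have hall : ∀ s : Finset ↥(Sᶜ), s.card ≤ (s.biUnion t).card := by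
    intro s
    have h1 : (Subtype.val '' (s : Set ↥(Sᶜ))).ncard = s.card := by
      rw [Set.ncard_image_of_injective _ Subtype.val_injective, Set.ncard_coe_finset]
    rw [← h1, ← Set.ncard_coe_finset]
    refine (hA _ ?_).trans (Set.ncard_le_ncard ?_)
    · rintro _ ⟨a, -, rfl⟩
      exact a.2
    · rintro b ⟨⟨_, ⟨a, ha, rfl⟩, hab⟩, hb⟩
      simp only [Finset.coe_biUnion, Set.mem_iUnion]
      exact ⟨a, ha, by simp [t, hb, hab]⟩
  obtain ⟨f, hf, hft⟩ := (Finset.all_card_le_biUnion_card_iff_exists_injective t).1 hall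
  have hft' : ∀ a, f a ∈ S ∧ H.Adj a (f a) := fun a => by simpa [t] using hft a
  let g : V → V := fun y => if hy : y ∈ Sᶜ then f ⟨y, hy⟩ else y
  have hg : ∀ y (hy : y ∈ Sᶜ), g y = f ⟨y, hy⟩ := fun y hy => dif_pos hy
  have hgm : H.IsMatchingInto S g := by
    refine ⟨fun y hy z hz hyz => ?_, fun y hy => ?_, fun y hy => ?_⟩
    · rw [hg y hy, hg z hz] at hyz
      simpa using hf hyz
    · rw [hg y hy]
      exact (hft' _).1
    · rw [hg y hy]
      exact (hft' ⟨y, hy⟩).2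
  exact absurd hgm.ncard_compl_le (not_le.2 h)

/-! ### Deleting an edge -/

/-- Every matching of `Sᶜ` into the independent set `S` is a maximum matching, so it uses each
`μ`-critical edge. -/
lemma IsMuCriticalEdge.exists_eq {e : Sym2 V} (hcr : G.IsMuCriticalEdge e) {S : Set V}
    (hS : G.IsIndepSet S) {f : V → V} (hf : G.IsMatchingInto S f) : ∃ y ∉ S, s(y, f y) = e := by
  by_contra! h
  have hf' : (G.deleteEdges {e}).IsMatchingInto S f :=
    ⟨hf.injOn, hf.mem, fun y hy => deleteEdges_adj.2 ⟨hf.adj y hy, h y hy⟩⟩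
  have h1 := hf'.ncard_compl_le
  have h2 := (hf.ncard_eq hS).2
  have h3 := hcr.2
  omega

/-- For a maximum independent set `S` of a König–Egerváry graph, an edge `xy` with `x ∈ S`
is `μ`-critical if and only if every matching of `Sᶜ` into `S` uses it. -/
lemma isMuCriticalEdge_iff (hG : G.IsKonigEgervary) {S : Set V} (hS : G.IsIndepSet S)
    (hc : S.ncard = G.indepNum) {x y : V} (hx : x ∈ S) (hadj : G.Adj x y) :
    G.IsMuCriticalEdge s(x, y) ↔ ∀ f, G.IsMatchingInto S f → f y = x := by
  have hy : y ∉ S := fun hy => hS.not_adj hx hy hadj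
  constructor
  · intro hcr f hf
    obtain ⟨z, hz, h⟩ := hcr.exists_eq hS hf
    rcases Sym2.eq_iff.1 h with ⟨rfl, -⟩ | ⟨rfl, h'⟩
    · exact absurd hx hz
    · exact h'
  · intro h
    refine ⟨hadj, ?_⟩
    by_contra! hμ
    obtain ⟨f, hf⟩ := (hS.deleteEdges {s(x, y)}).exists_isMatchingInto
      (by rw [← hG, hc]; omega)
    have hfy := hf.adj y hy
    rw [h f ⟨hf.injOn, hf.mem, fun z hz => deleteEdges_le _ (hf.adj z hz)⟩] at hfy
    simp [Sym2.eq_swap] at hfy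

lemma indepNum_le_indepNum_deleteEdges (G : SimpleGraph V) (s : Set (Sym2 V)) :
    G.indepNum ≤ (G.deleteEdges s).indepNum := by
  obtain ⟨S, hS, hc⟩ := G.exists_isIndepSet_ncard_eq
  exact hc ▸ (hS.deleteEdges s).ncard_le_indepNum

/-- A `μ`-critical edge whose endpoints both avoid some maximum independent set is also critical
for the independence number. If `S`, `T` are maximum independent sets containing `u` and `v`
respectively, Hall's theorem in `G - uv` yields a set `A ⊆ Sᶜ` with fewer than `|A|` neighbors
`B` in `S`, and exchanging `B` for `T ∩ (A ∪ B)` in `S` produces a larger independent set of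
`G - uv`. -/
lemma IsMuCriticalEdge.indepNum_lt (hG : G.IsKonigEgervary) {u v : V}
    (hcr : G.IsMuCriticalEdge s(u, v)) {S T : Set V} (hS : G.IsIndepSet S)
    (hSc : S.ncard = G.indepNum) (hT : G.IsIndepSet T) (hTc : T.ncard = G.indepNum)
    (hu : u ∈ S) (hv : v ∈ T) :
    G.indepNum < (G.deleteEdges {s(u, v)}).indepNum := by
  classical
  set H := G.deleteEdges {s(u, v)} with hH
  have hadj : G.Adj u v := hcr.1
  have hvS : v ∉ S := fun h => hS.not_adj hu h hadj
  obtain ⟨f, hf⟩ := hG.exists_isMatchingInto hS hSc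
  have hfv : f v = u := (isMuCriticalEdge_iff hG hS hSc hu hadj).1 hcr f hf
  obtain ⟨A, hAS, hA⟩ := exists_ncard_nbhd_inter_lt (H := H) (S := S)
    (by rw [(hf.ncard_eq hS).2]; exact hcr.2)
  set B := H.nbhd A ∩ S with hB
  have hind : H.IsIndepSet ((S \ B) ∪ (T ∩ (A ∪ B))) := by
    have hSH : ∀ x ∈ S, ∀ y ∈ S, ¬ H.Adj x y :=
      fun x hx y hy => (hS.deleteEdges {s(u, v)}).not_adj hx hy
    have hmix : ∀ x ∈ S \ B, ∀ y ∈ T ∩ (A ∪ B), ¬ H.Adj y x := by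
      rintro x ⟨hx, hxB⟩ y ⟨-, hyA | hyB⟩ h
      · exact hxB ⟨⟨y, hyA, h⟩, hx⟩
      · exact hSH y hyB.2 x hx h
    apply isIndepSet_of_forall_not_adj
    rintro x (hx | hx) y (hy | hy) h
    · exact hSH x hx.1 y hy.1 h
    · exact hmix x hx y hy h.symm
    · exact hmix y hy x hx h
    · exact (hT.deleteEdges {s(u, v)}).not_adj hx.1 hy.1 h
  -- Every vertex of `A` or its mate lies in `T`, and mates of vertices of `A \ T` lie in `B`
  -- because the only matching edge missing in `G - uv` starts at `v ∈ T`.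
  have hcard : A.ncard ≤ (T ∩ (A ∪ B)).ncard := by
    refine Set.ncard_le_ncard_of_injOn (fun a => if a ∈ T then a else f a) ?_ ?_
    · intro a ha
      by_cases haT : a ∈ T
      · simp only [haT, if_true]
        exact ⟨haT, Or.inl ha⟩
      · simp only [haT, if_false]
        refine ⟨(hf.mem_or_mem hT (hTc.trans hSc.symm) (hAS ha)).resolve_left haT,
          Or.inr ⟨⟨a, ha, ?_⟩, hf.mem a (hAS ha)⟩⟩
        rw [hH, deleteEdges_adj]
        refine ⟨hf.adj a (hAS ha), fun h => ?_⟩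
        rcases Sym2.eq_iff.1 (Set.mem_singleton_iff.1 h) with ⟨rfl, -⟩ | ⟨rfl, -⟩
        · exact hAS ha hu
        · exact haT hv
    · intro a ha b hb hab
      simp only at hab
      split_ifs at hab
      · exact hab
      · exact absurd (hab ▸ hf.mem b (hAS hb)) (hAS ha)
      · exact absurd (hab ▸ hf.mem a (hAS ha)) (hAS hb)
      · exact hf.injOn (hAS ha) (hAS hb) hab
  have hdisj : Disjoint (S \ B) (T ∩ (A ∪ B)) := by
    rw [Set.disjoint_left]
    rintro x ⟨hx, hxB⟩ ⟨-, hxA | h⟩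
    · exact hAS hxA hx
    · exact hxB h
  have h1 := hind.ncard_le_indepNum
  rw [Set.ncard_union_eq hdisj] at h1
  have h2 := Set.ncard_sdiff_add_ncard_of_subset (s := B) (t := S) Set.inter_subset_right
  omega

/-- Deleting an edge of a König–Egerváry graph destroys the König–Egerváry property exactly if
the edge is `μ`-critical and joins the core to its neighborhood. -/
lemma not_isKonigEgervary_deleteEdges_iff (hG : G.IsKonigEgervary) {e : Sym2 V}
    (he : e ∈ G.edgeSet) :
    ¬ (G.deleteEdges {e}).IsKonigEgervary ↔
      e ∈ G.edgesBetween G.core (G.nbhd G.core) ∧ G.IsMuCriticalEdge e := by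
  have hle := (G.deleteEdges {e}).indepNum_add_matchingNum_le
  have hα := G.indepNum_le_indepNum_deleteEdges {e}
  have hsum : G.indepNum + G.matchingNum = Nat.card V := hG
  constructor
  · intro hnot
    have hcr : G.IsMuCriticalEdge e := by
      refine ⟨he, ?_⟩
      by_contra! h
      exact hnot (by unfold IsKonigEgervary; omega)
    refine ⟨?_, hcr⟩
    by_contra hbet
    induction e with
    | _ u v =>
      have hadj : G.Adj u v := he
      have hu : u ∉ G.core := fun h => hbet ⟨u, h, v, ⟨u, h, hadj⟩, hadj, rfl⟩
      have hv : v ∉ G.core := fun h => hbet ⟨v, h, u, ⟨v, h, hadj.symm⟩, hadj.symm, Sym2.eq_swap⟩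
      rw [mem_core_iff] at hu hv
      push Not at hu hv
      obtain ⟨T, hT, hTc, huT⟩ := hu
      obtain ⟨S, hS, hSc, hvS⟩ := hv
      -- A critical edge has an end in every maximum independent set.
      have hmem : ∀ {S : Set V} {x y : V}, G.IsIndepSet S → S.ncard = G.indepNum →
          G.IsMuCriticalEdge s(x, y) → x ∉ S → y ∈ S := by
        intro S x y hS hSc hxy hx
        obtain ⟨f, hf⟩ := hG.exists_isMatchingInto hS hSc
        obtain ⟨z, hz, h⟩ := hxy.exists_eq hS hf
        rcases Sym2.eq_iff.1 h with ⟨-, h⟩ | ⟨-, h⟩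
        · exact h ▸ hf.mem z hz
        · exact absurd (h ▸ hf.mem z hz) hx
      have hvT := hmem hT hTc hcr huT
      have huS := hmem hS hSc (Sym2.eq_swap ▸ hcr) hvS
      have hlt := hcr.indepNum_lt hG hS hSc hT hTc huS hvT
      obtain ⟨f, hf⟩ := hG.exists_isMatchingInto hS hSc
      -- Removing one edge lowers the matching number by at most one.
      have hμ : (Sᶜ \ {v}).ncard ≤ (G.deleteEdges {s(u, v)}).matchingNum := by
        refine ncard_le_matchingNum (f := f) (hf.injOn.mono Set.sdiff_subset)
          (fun c hc h => h.1 (hf.mem c hc.1)) fun c hc => ?_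
        rw [deleteEdges_adj]
        refine ⟨hf.adj c hc.1, fun h => ?_⟩
        rcases Sym2.eq_iff.1 (Set.mem_singleton_iff.1 h) with ⟨rfl, -⟩ | ⟨rfl, -⟩
        · exact hc.1 huS
        · exact hc.2 rfl
      have h1 := Set.ncard_sdiff_singleton_add_one (s := Sᶜ) hvS
      have h2 := (hf.ncard_eq hS).2
      exact hnot (by unfold IsKonigEgervary; omega)
  · rintro ⟨⟨a, ha, b, -, hab, rfl⟩, hcr⟩ hKE
    -- A maximum independent set of `G - ab` has more than `α(G)` elements; without `a` it is a
    -- maximum independent set of `G` that misses `a`.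
    obtain ⟨T, hT, hTc⟩ := (G.deleteEdges {s(a, b)}).exists_isIndepSet_ncard_eq
    have hKE' : (G.deleteEdges {s(a, b)}).indepNum +
      (G.deleteEdges {s(a, b)}).matchingNum = Nat.card V := hKE
    have hind : G.IsIndepSet (T \ {a}) := by
      apply isIndepSet_of_forall_not_adj
      rintro x ⟨hx, hxa⟩ y ⟨hy, hya⟩ h
      refine hT.not_adj hx hy ?_
      rw [deleteEdges_adj]
      refine ⟨h, fun h' => ?_⟩
      rcases Sym2.eq_iff.1 (Set.mem_singleton_iff.1 h') with ⟨rfl, -⟩ | ⟨-, rfl⟩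
      · exact hxa rfl
      · exact hya rfl
    have h1 := Set.pred_ncard_le_ncard_sdiff_singleton T a
    have h2 := hind.ncard_le_indepNum
    have h3 := hcr.2
    have := mem_core_iff.1 ha _ hind (by omega)
    exact this.2 rfl

lemma numMuCriticalCoreEdges_add_rhoE (hG : G.IsKonigEgervary) :
    G.numMuCriticalCoreEdges + G.rhoE = G.edgeSet.ncard := by
  have hdisj : Disjoint {e | e ∈ G.edgesBetween G.core (G.nbhd G.core) ∧ G.IsMuCriticalEdge e}
      {e | e ∈ G.edgeSet ∧ (G.deleteEdges {e}).IsKonigEgervary} := by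
    rw [Set.disjoint_left]
    rintro e he ⟨heG, h⟩
    exact (not_isKonigEgervary_deleteEdges_iff hG heG).2 he h
  rw [numMuCriticalCoreEdges, rhoE, ← Set.ncard_union_eq hdisj]
  congr 1
  ext e
  constructor
  · rintro (h | h)
    · exact h.2.1
    · exact h.1
  · intro he
    by_cases h : (G.deleteEdges {e}).IsKonigEgervary
    · exact Or.inr ⟨he, h⟩
    · exact Or.inl ((not_isKonigEgervary_deleteEdges_iff hG he).1 h)

/-! ### Critical independent sets -/

/-- A matching of `Sᶜ` into `S` bounds every difference `d(B)` by `|S| - |Sᶜ|`. -/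
lemma IsMatchingInto.setDifference_le {S : Set V} {f : V → V} (hf : G.IsMatchingInto S f)
    (B : Set V) : G.setDifference B ≤ (S.ncard : ℤ) - (Sᶜ.ncard : ℤ) := by
  have h1 : (B \ S).ncard ≤ (G.nbhd B ∩ S).ncard :=
    Set.ncard_le_ncard_of_injOn f (fun y hy => ⟨⟨y, hy.1, hf.adj y hy.2⟩, hf.mem y hy.2⟩)
      (hf.injOn.mono fun _ hy => hy.2)
  have h2 : (Sᶜ \ G.nbhd B).ncard ≤ (S \ B).ncard :=
    Set.ncard_le_ncard_of_injOn f
      (fun y hy => ⟨hf.mem y hy.1, fun h => hy.2 ⟨f y, h, (hf.adj y hy.1).symm⟩⟩)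
      (hf.injOn.mono fun _ hy => hy.1)
  have h3 := Set.ncard_inter_add_ncard_sdiff_eq_ncard B S
  have h4 := Set.ncard_inter_add_ncard_sdiff_eq_ncard S B
  have h5 := Set.ncard_inter_add_ncard_sdiff_eq_ncard (G.nbhd B) S
  have h6 := Set.ncard_inter_add_ncard_sdiff_eq_ncard Sᶜ (G.nbhd B)
  have h7 : G.nbhd B \ S = Sᶜ ∩ G.nbhd B := by
    ext; simp [and_comm]
  rw [Set.inter_comm S B] at h4
  rw [h7] at h5
  unfold setDifference
  omega

lemma isCriticalIndepSet_iff {S : Set V} {f : V → V} (hf : G.IsMatchingInto S f)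
    (hS : G.IsIndepSet S) {A : Set V} :
    G.IsCriticalIndepSet A ↔
      G.IsIndepSet A ∧ G.setDifference A = (S.ncard : ℤ) - (Sᶜ.ncard : ℤ) := by
  have hSd : (S.ncard : ℤ) - (Sᶜ.ncard : ℤ) ≤ G.setDifference S := by
    have : (G.nbhd S).ncard ≤ Sᶜ.ncard := by
      refine Set.ncard_le_ncard ?_
      rintro y ⟨x, hx, hxy⟩ hy
      exact hS.not_adj hx hy hxy
    unfold setDifference
    omega
  constructor
  · rintro ⟨h1, h2⟩
    exact ⟨h1, le_antisymm (hf.setDifference_le A) (hSd.trans (h2 S))⟩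
  · rintro ⟨h1, h2⟩
    exact ⟨h1, fun B => h2 ▸ hf.setDifference_le B⟩

/-- The difference is supermodular, so critical independent sets are closed under
intersection. -/
lemma IsCriticalIndepSet.inter {A B : Set V} (hA : G.IsCriticalIndepSet A)
    (hB : G.IsCriticalIndepSet B) : G.IsCriticalIndepSet (A ∩ B) := by
  refine ⟨hA.1.mono Set.inter_subset_left, fun D => ?_⟩
  have h1 : (G.nbhd (A ∩ B)).ncard ≤ (G.nbhd A ∩ G.nbhd B).ncard := by
    refine Set.ncard_le_ncard ?_
    rintro y ⟨x, hx, hxy⟩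
    exact ⟨⟨x, hx.1, hxy⟩, ⟨x, hx.2, hxy⟩⟩
  have h2 : G.nbhd (A ∪ B) = G.nbhd A ∪ G.nbhd B := by
    ext y
    simp [nbhd, or_and_right, exists_or]
  have h3 := Set.ncard_union_add_ncard_inter A B
  have h4 := Set.ncard_union_add_ncard_inter (G.nbhd A) (G.nbhd B)
  have h5 := hA.2 (A ∪ B)
  have h6 := hB.2 D
  unfold setDifference at *
  rw [h2] at h5
  omega

lemma isCriticalIndepSet_sInter {F : Set (Set V)} (hF : ∀ A ∈ F, G.IsCriticalIndepSet A)
    (hne : F.Nonempty) : G.IsCriticalIndepSet (⋂₀ F) := by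
  obtain ⟨A₀, hA₀⟩ := hne
  obtain ⟨A, hA⟩ := (Set.toFinite {A : Set V | G.IsCriticalIndepSet A ∧ ⋂₀ F ⊆ A}).exists_minimal
    ⟨A₀, hF A₀ hA₀, Set.sInter_subset_of_mem hA₀⟩
  -- A minimal critical independent set containing `⋂₀ F` is contained in each member of `F`.
  have hsub : A ⊆ ⋂₀ F := Set.subset_sInter fun B hB =>
    (hA.2 ⟨hA.1.1.inter (hF B hB), Set.subset_inter hA.1.2 (Set.sInter_subset_of_mem hB)⟩
      Set.inter_subset_left).trans Set.inter_subset_right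
  exact hA.1.2.antisymm hsub ▸ hA.1.1

lemma IsKonigEgervary.isCriticalIndepSet (hG : G.IsKonigEgervary) {S : Set V}
    (hS : G.IsIndepSet S) (hc : S.ncard = G.indepNum) : G.IsCriticalIndepSet S := by
  obtain ⟨f, hf⟩ := hG.exists_isMatchingInto hS hc
  refine (isCriticalIndepSet_iff hf hS).2 ⟨hS, ?_⟩
  have : G.nbhd S = Sᶜ := by
    ext y
    constructor
    · rintro ⟨x, hx, hxy⟩ hy
      exact hS.not_adj hx hy hxy
    · intro hy
      exact ⟨f y, hf.mem y hy, (hf.adj y hy).symm⟩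
  rw [setDifference, this]

lemma core_eq_sInter (G : SimpleGraph V) :
    G.core = ⋂₀ {S | G.IsIndepSet S ∧ S.ncard = G.indepNum} := by
  ext v
  simp [mem_core_iff]

lemma IsKonigEgervary.isCriticalIndepSet_core (hG : G.IsKonigEgervary) :
    G.IsCriticalIndepSet G.core := by
  rw [core_eq_sInter]
  exact isCriticalIndepSet_sInter (fun S hS => hG.isCriticalIndepSet hS.1 hS.2)
    G.exists_isIndepSet_ncard_eq

lemma IsKonigEgervary.isCriticalIndepSet_criticalKer (hG : G.IsKonigEgervary) :
    G.IsCriticalIndepSet G.criticalKer := by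
  have h : G.criticalKer = ⋂₀ {A | G.IsCriticalIndepSet A} := rfl
  rw [h]
  exact isCriticalIndepSet_sInter (fun A hA => hA) ⟨_, hG.isCriticalIndepSet_core⟩

lemma IsKonigEgervary.criticalKer_subset_core (hG : G.IsKonigEgervary) :
    G.criticalKer ⊆ G.core :=
  fun _ hv => hv _ hG.isCriticalIndepSet_core

/-- By counting, a matching of `Sᶜ` into `S` restricts to a bijection from `Sᶜ \ N(A)` onto
`S \ A` whenever `A ⊆ S` is critical. -/
lemma IsMatchingInto.image_compl_diff_nbhd {S A : Set V} {f : V → V} (hf : G.IsMatchingInto S f)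
    (hS : G.IsIndepSet S) (hA : G.IsCriticalIndepSet A) (hAS : A ⊆ S) :
    f '' (Sᶜ \ G.nbhd A) = S \ A := by
  refine Set.eq_of_subset_of_ncard_le ?_ ?_
  · rintro _ ⟨y, ⟨hy, hyA⟩, rfl⟩
    exact ⟨hf.mem y hy, fun h => hyA ⟨f y, h, (hf.adj y hy).symm⟩⟩
  · rw [(hf.injOn.mono Set.sdiff_subset).ncard_image]
    have h1 := ((isCriticalIndepSet_iff hf hS).1 hA).2
    have h2 := Set.ncard_sdiff_add_ncard_of_subset hAS
    have h3 : G.nbhd A ⊆ Sᶜ := by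
      rintro y ⟨x, hx, hxy⟩ hy
      exact hS.not_adj (hAS hx) hy hxy
    have h4 := Set.ncard_sdiff_add_ncard_of_subset h3
    unfold setDifference at h1
    omega

lemma IsMatchingInto.mem_of_mem_nbhd {S A : Set V} {f : V → V} (hf : G.IsMatchingInto S f)
    (hS : G.IsIndepSet S) (hA : G.IsCriticalIndepSet A) (hAS : A ⊆ S) {y : V}
    (hy : y ∈ G.nbhd A) : f y ∈ A := by
  have hyS : y ∉ S := by
    obtain ⟨x, hx, hxy⟩ := hy
    exact fun h => hS.not_adj (hAS hx) h hxy
  by_contra h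
  obtain ⟨z, hz, hzy⟩ : f y ∈ f '' (Sᶜ \ G.nbhd A) := by
    rw [hf.image_compl_diff_nbhd hS hA hAS]
    exact ⟨hf.mem y hyS, h⟩
  exact hz.2 (hf.injOn hz.1 hyS hzy ▸ hy)

/-- A `μ`-critical edge of a König–Egerváry graph has no endpoint `x` in the kernel: with `A ⊆ Sᶜ`
violating Hall's condition in `G - xy`, removing from `S` the vertex `x` and the neighbors of `A`
leaves a critical independent set. -/
lemma IsMuCriticalEdge.notMem_criticalKer (hG : G.IsKonigEgervary) {S : Set V}
    (hS : G.IsIndepSet S) (hc : S.ncard = G.indepNum) {x y : V} (hx : x ∈ S)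
    (hcr : G.IsMuCriticalEdge s(x, y)) : x ∉ G.criticalKer := by
  have hy : y ∉ S := fun hy => hS.not_adj hx hy hcr.1
  obtain ⟨f, hf⟩ := hG.exists_isMatchingInto hS hc
  obtain ⟨A, hAS, hA⟩ := exists_ncard_nbhd_inter_lt (H := G.deleteEdges {s(x, y)}) (S := S)
    (by rw [(hf.ncard_eq hS).2]; exact hcr.2)
  set B := (G.deleteEdges {s(x, y)}).nbhd A ∩ S with hB
  have hN : G.nbhd ((S \ B) \ {x}) ⊆ Sᶜ \ A := by
    rintro w ⟨z, ⟨⟨hz, hzB⟩, hzx⟩, hzw⟩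
    refine ⟨fun hw => hS.not_adj hz hw hzw, fun hwA => hzB ⟨⟨w, hwA, ?_⟩, hz⟩⟩
    rw [deleteEdges_adj]
    refine ⟨hzw.symm, fun h => ?_⟩
    rcases Sym2.eq_iff.1 (Set.mem_singleton_iff.1 h) with ⟨-, rfl⟩ | ⟨-, rfl⟩
    · exact hy hz
    · exact hzx rfl
  have hcrit : G.IsCriticalIndepSet ((S \ B) \ {x}) := by
    refine (isCriticalIndepSet_iff hf hS).2
      ⟨hS.mono (Set.sdiff_subset.trans Set.sdiff_subset), le_antisymm (hf.setDifference_le _) ?_⟩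
    have h1 := Set.ncard_le_ncard hN
    have h2 := Set.ncard_sdiff_add_ncard_of_subset hAS
    have h3 := Set.ncard_sdiff_add_ncard_of_subset (s := B) (t := S) Set.inter_subset_right
    have h4 := Set.pred_ncard_le_ncard_sdiff_singleton (S \ B) x
    unfold setDifference
    omega
  exact fun h => (h _ hcrit).2 rfl

/-! ### The possible values -/

/-- With `k = ξ(G) - ε(G)`, let `f₀` match `Sᶜ` into `S`, and let `Y` be the set of the `k`
vertices whose mates lie in `core(G) \ ker(G)`. Every matching of `Sᶜ` into `S` maps `Y` onto
`core(G) \ ker(G)`, so it cannot disagree with `f₀` at a single vertex of `Y` only. -/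
lemma numMuCriticalCoreEdges_eq_or_le (hG : G.IsKonigEgervary) :
    G.numMuCriticalCoreEdges = G.xi - G.eps ∨ G.numMuCriticalCoreEdges + 2 ≤ G.xi - G.eps := by
  obtain ⟨S, hS, hc⟩ := G.exists_isIndepSet_ncard_eq
  obtain ⟨f₀, hf₀⟩ := hG.exists_isMatchingInto hS hc
  have hcoreS : G.core ⊆ S := fun v hv => mem_core_iff.1 hv S hS hc
  have hkc := hG.criticalKer_subset_core
  have hcore := hG.isCriticalIndepSet_core
  have hker := hG.isCriticalIndepSet_criticalKer
  let Y : Set V := {y | y ∉ S ∧ f₀ y ∈ G.core \ G.criticalKer}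
  let Q : Set V := {y | y ∈ Y ∧ ∀ f, G.IsMatchingInto S f → f y = f₀ y}
  have hYimg : f₀ '' Y = G.core \ G.criticalKer := by
    ext x
    constructor
    · rintro ⟨y, hy, rfl⟩
      exact hy.2
    · intro hx
      obtain ⟨y, hy, rfl⟩ : x ∈ f₀ '' (Sᶜ \ G.nbhd G.criticalKer) := by
        rw [hf₀.image_compl_diff_nbhd hS hker (hkc.trans hcoreS)]
        exact ⟨hcoreS hx.1, hx.2⟩
      exact ⟨y, ⟨hy.1, hx⟩, rfl⟩
  have hYcard : Y.ncard = G.xi - G.eps := by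
    rw [← (hf₀.injOn.mono fun y (hy : y ∈ Y) => hy.1).ncard_image, hYimg, xi, eps,
      Set.ncard_sdiff hkc]
  have hQcard : G.numMuCriticalCoreEdges = Q.ncard := by
    have hinj : Set.InjOn (fun y => s(f₀ y, y)) Q := by
      intro y hy z hz h
      rcases Sym2.eq_iff.1 h with ⟨-, h⟩ | ⟨h, -⟩
      · exact h
      · exact absurd (h ▸ hf₀.mem y hy.1.1) hz.1.1
    rw [← hinj.ncard_image, numMuCriticalCoreEdges]
    congr 1
    ext e
    constructor
    · rintro ⟨⟨a, ha, b, hb, hab, rfl⟩, hcr⟩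
      have haS := hcoreS ha
      have hall := (isMuCriticalEdge_iff hG hS hc haS hab).1 hcr
      have h0 := hall f₀ hf₀
      refine ⟨b, ⟨⟨fun h => hS.not_adj haS h hab, ?_⟩, fun f hf => (hall f hf).trans h0.symm⟩, ?_⟩
      · rw [h0]
        exact ⟨ha, hcr.notMem_criticalKer hG hS hc haS⟩
      · simp only [h0]
    · rintro ⟨y, ⟨⟨hyS, hy⟩, hall⟩, rfl⟩
      have hadj := (hf₀.adj y hyS).symm
      exact ⟨⟨f₀ y, hy.1, y, ⟨f₀ y, hy.1, hadj⟩, hadj, rfl⟩,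
        (isMuCriticalEdge_iff hG hS hc (hcoreS hy.1) hadj).2 hall⟩
  have hne : (Y \ Q).ncard ≠ 1 := by
    intro h
    obtain ⟨y₀, hy₀⟩ := Set.ncard_eq_one.1 h
    have hmem : y₀ ∈ Y \ Q := hy₀ ▸ rfl
    obtain ⟨⟨hyS, hyc, hyk⟩, hyQ⟩ := hmem
    refine hyQ ⟨⟨hyS, hyc, hyk⟩, fun f hf => ?_⟩
    have hadj₀ := (hf₀.adj y₀ hyS).symm
    have h1 : f y₀ ∈ G.core := hf.mem_of_mem_nbhd hS hcore hcoreS ⟨f₀ y₀, hyc, hadj₀⟩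
    have h2 : f y₀ ∉ G.criticalKer := fun hk =>
      hyk (hf₀.mem_of_mem_nbhd hS hker (hkc.trans hcoreS) ⟨f y₀, hk, (hf.adj y₀ hyS).symm⟩)
    obtain ⟨y₁, hy₁, hy₁₀⟩ : f y₀ ∈ f₀ '' Y := hYimg ▸ ⟨h1, h2⟩
    by_cases h' : y₁ ∈ Q
    · have : y₁ = y₀ := hf.injOn hy₁.1 hyS ((h'.2 f hf).trans hy₁₀)
      rw [← hy₁₀, this]
    · have : y₁ ∈ Y \ Q := ⟨hy₁, h'⟩
      rw [hy₀, Set.mem_singleton_iff] at this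
      rw [← hy₁₀, this]
  have := Set.ncard_sdiff_add_ncard_of_subset (s := Q) (t := Y) fun y hy => hy.1
  omega

end Finite

/-! ### The graphs `G_p^q` -/

section CliqueFamily

variable {p q : ℕ}

lemma cliqueFamily_iso_adj (φ : cliqueFamily p q ≃g G) (x y : Fin p ⊕ Fin p) :
    G.Adj (φ x) (φ y) ↔ (cliqueFamily p q).Adj x y :=
  φ.map_adj_iff

lemma isIndepSet_range_inr (φ : cliqueFamily p q ≃g G) :
    G.IsIndepSet (Set.range fun j => φ (Sum.inr j)) := by
  apply isIndepSet_of_forall_not_adj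
  rintro _ ⟨i, rfl⟩ _ ⟨j, rfl⟩ h
  exact (cliqueFamily_iso_adj φ _ _).1 h

lemma compl_range_inr (φ : cliqueFamily p q ≃g G) :
    (Set.range fun j => φ (Sum.inr j))ᶜ = Set.range fun i => φ (Sum.inl i) := by
  ext v
  obtain ⟨i | i, rfl⟩ := φ.surjective v <;> simp

/-- A permutation `σ` of the indices for which `a_i` and `b_{σ i}` are always adjacent gives a
perfect matching. -/
lemma isMatchingInto_of_perm (φ : cliqueFamily p q ≃g G) (σ : Equiv.Perm (Fin p))
    (hσ : ∀ i, σ i = i ∨ (σ i).val < q) :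
    G.IsMatchingInto (Set.range fun j => φ (Sum.inr j))
      (fun v => φ (Sum.elim (fun i => Sum.inr (σ i)) Sum.inl (φ.symm v))) := by
  refine ⟨?_, fun y hy => ?_, fun y hy => ?_⟩
  · rw [compl_range_inr]
    rintro _ ⟨i, rfl⟩ _ ⟨j, rfl⟩ h
    simpa using h
  all_goals
    obtain ⟨i, rfl⟩ : y ∈ Set.range fun i => φ (Sum.inl i) := compl_range_inr φ ▸ hy
  · simp
  · simp only [RelIso.symm_apply_apply, Sum.elim_inl]
    exact (cliqueFamily_iso_adj φ _ _).2 (hσ i)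

lemma isMatchingInto_refl (φ : cliqueFamily p q ≃g G) :
    G.IsMatchingInto (Set.range fun j => φ (Sum.inr j))
      (fun v => φ (Sum.elim (fun i => Sum.inr i) Sum.inl (φ.symm v))) :=
  isMatchingInto_of_perm φ (Equiv.refl _) fun _ => Or.inl rfl

lemma ncard_range_inr (φ : cliqueFamily p q ≃g G) :
    (Set.range fun j => φ (Sum.inr j)).ncard = p := by
  have hinj : Function.Injective fun j : Fin p => φ (Sum.inr j) :=
    φ.injective.comp Sum.inr_injective
  rw [Set.ncard_range_of_injective hinj, Nat.card_fin]

lemma ncard_compl_range_inr (φ : cliqueFamily p q ≃g G) :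
    (Set.range fun j => φ (Sum.inr j))ᶜ.ncard = p := by
  have hinj : Function.Injective fun i : Fin p => φ (Sum.inl i) :=
    φ.injective.comp Sum.inl_injective
  rw [compl_range_inr, Set.ncard_range_of_injective hinj, Nat.card_fin]

variable [Finite V]

lemma isKonigEgervary_of_cliqueFamily_iso (φ : cliqueFamily p q ≃g G) : G.IsKonigEgervary :=
  (isMatchingInto_refl φ).isKonigEgervary (isIndepSet_range_inr φ)

lemma indepNum_of_cliqueFamily_iso (φ : cliqueFamily p q ≃g G) : G.indepNum = p := by
  rw [← ((isMatchingInto_refl φ).ncard_eq (isIndepSet_range_inr φ)).1, ncard_range_inr]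

lemma isCriticalIndepSet_empty_of_cliqueFamily_iso (φ : cliqueFamily p q ≃g G) :
    G.IsCriticalIndepSet ∅ := by
  refine (isCriticalIndepSet_iff (isMatchingInto_refl φ) (isIndepSet_range_inr φ)).2
    ⟨by simp [IsIndepSet], ?_⟩
  rw [ncard_range_inr, ncard_compl_range_inr]
  simp [setDifference, nbhd]

lemma eps_of_cliqueFamily_iso (φ : cliqueFamily p q ≃g G) : G.eps = 0 := by
  have : G.criticalKer = ∅ :=
    Set.subset_empty_iff.1 fun v hv => hv ∅ (isCriticalIndepSet_empty_of_cliqueFamily_iso φ)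
  rw [eps, this, Set.ncard_empty]

/-- If `b_{j'}` with `j' ≠ j` is adjacent to the whole clique, then `b_j` is in the core: a
maximum independent set without `b_j` would contain `a_j`, hence neither `a_{j'}` nor `b_{j'}`. -/
lemma inr_mem_core (φ : cliqueFamily p q ≃g G) {j j' : Fin p} (hj' : j'.val < q) (hne : j' ≠ j) :
    φ (Sum.inr j) ∈ G.core := by
  rw [mem_core_iff]
  intro T hT hTc
  have hpair : ∀ i, φ (Sum.inl i) ∈ T ∨ φ (Sum.inr i) ∈ T := by
    intro i
    have hi : φ (Sum.inl i) ∉ Set.range fun j => φ (Sum.inr j) := by simp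
    simpa using (isMatchingInto_refl φ).mem_or_mem hT
      (by rw [hTc, indepNum_of_cliqueFamily_iso φ, ncard_range_inr]) hi
  by_contra h
  have hj := (hpair j).resolve_right h
  rcases hpair j' with h' | h'
  · exact hT.not_adj hj h' ((cliqueFamily_iso_adj φ _ _).2 hne.symm)
  · exact hT.not_adj hj h' ((cliqueFamily_iso_adj φ _ _).2 (Or.inr hj'))

lemma core_subset_range_inr (φ : cliqueFamily p q ≃g G) :
    G.core ⊆ Set.range fun j => φ (Sum.inr j) :=
  fun _ hv => mem_core_iff.1 hv _ (isIndepSet_range_inr φ)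
    (by rw [indepNum_of_cliqueFamily_iso φ, ncard_range_inr])

lemma xi_of_cliqueFamily_iso (φ : cliqueFamily p q ≃g G) (hq : 2 ≤ q) (hqp : q ≤ p) : G.xi = p := by
  have : G.core = Set.range fun j => φ (Sum.inr j) := by
    refine (core_subset_range_inr φ).antisymm ?_
    rintro _ ⟨j, rfl⟩
    by_cases hj : j.val = 0
    · exact inr_mem_core φ (j' := ⟨1, by omega⟩) hq (by rw [Ne, Fin.ext_iff]; simp [hj])
    · exact inr_mem_core φ (j' := ⟨0, by omega⟩) (by simp; omega)
        (by rw [Ne, Fin.ext_iff]; simp; omega)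
  rw [xi, this, ncard_range_inr]

end CliqueFamily

section CliqueFamilyOne

variable [Finite V] {p : ℕ}

/-- For `q = 1` the set `{a_1, b_2, …, b_p}` is another maximum independent set. -/
lemma inr_zero_notMem_core (φ : cliqueFamily (p + 1) 1 ≃g G) : φ (Sum.inr 0) ∉ G.core := by
  rw [mem_core_iff]
  intro h
  set S := Set.range fun j => φ (Sum.inr j) with hS
  have hmem : φ (Sum.inr 0) ∈ S := ⟨0, rfl⟩
  have hnot : φ (Sum.inl 0) ∉ S := by simp [hS]
  have hadj : ∀ x ∈ S \ {φ (Sum.inr 0)}, ¬ G.Adj (φ (Sum.inl 0)) x := by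
    rintro _ ⟨⟨j, rfl⟩, hj⟩ hadj
    rcases (cliqueFamily_iso_adj φ _ _).1 hadj with rfl | h0
    · exact hj rfl
    · obtain rfl : j = 0 := by ext; simpa using h0
      exact hj rfl
  have hind : G.IsIndepSet (insert (φ (Sum.inl 0)) (S \ {φ (Sum.inr 0)})) := by
    apply isIndepSet_of_forall_not_adj
    rintro x (rfl | hx) y (rfl | hy) hxy
    · exact hxy.ne rfl
    · exact hadj y hy hxy
    · exact hadj x hx hxy.symm
    · exact (isIndepSet_range_inr φ).not_adj hx.1 hy.1 hxy
  have := h _ hind (by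
    rw [Set.ncard_exchange hnot hmem, indepNum_of_cliqueFamily_iso φ, ncard_range_inr])
  simp at this

lemma xi_of_cliqueFamily_one_iso (φ : cliqueFamily (p + 1) 1 ≃g G) : G.xi = p := by
  have : G.core = (Set.range fun j => φ (Sum.inr j)) \ {φ (Sum.inr 0)} := by
    apply Set.Subset.antisymm
    · intro v hv
      refine ⟨core_subset_range_inr φ hv, ?_⟩
      rintro rfl
      exact inr_zero_notMem_core φ hv
    · rintro _ ⟨⟨j, rfl⟩, hj⟩
      refine inr_mem_core φ (j' := 0) Nat.one_pos ?_
      rintro rfl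
      exact hj rfl
  have h0 : φ (Sum.inr 0) ∈ Set.range fun j => φ (Sum.inr j) := ⟨0, rfl⟩
  rw [xi, this, Set.ncard_sdiff_singleton_of_mem h0, ncard_range_inr, Nat.add_sub_cancel]

end CliqueFamilyOne

section CliqueFamilyCount

variable [Finite V] {p q : ℕ}

/-- The perfect matchings of `G_p^q` can be permuted freely on the indices `j ≤ q`, while `b_j` is
a leaf for `j > q`; hence the `μ`-critical edges are the `p - q` edges at these leaves. For `q = 1`
the edge `a_1 b_1` is `μ`-critical too, but `b_1` is not in the core. -/
lemma numMuCriticalCoreEdges_of_cliqueFamily_iso (φ : cliqueFamily p q ≃g G)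
    (hq : 1 ≤ q) (hqp : q ≤ p) :
    G.numMuCriticalCoreEdges = p - q := by
  classical
  have hG := isKonigEgervary_of_cliqueFamily_iso φ
  have hS := isIndepSet_range_inr φ
  have hc : (Set.range fun j => φ (Sum.inr j)).ncard = G.indepNum := by
    rw [indepNum_of_cliqueFamily_iso φ, ncard_range_inr]
  have hset : {e | e ∈ G.edgesBetween G.core (G.nbhd G.core) ∧ G.IsMuCriticalEdge e} =
      (fun j => s(φ (Sum.inr j), φ (Sum.inl j))) '' {j : Fin p | q ≤ j.val} := by
    ext e
    constructor
    · rintro ⟨⟨a, ha, b, hb, hab, rfl⟩, hcr⟩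
      obtain ⟨j, rfl⟩ := core_subset_range_inr φ ha
      obtain ⟨i | i, rfl⟩ := φ.surjective b
      swap
      · exact ((cliqueFamily_iso_adj φ _ _).1 hab).elim
      have hall := (isMuCriticalEdge_iff hG hS hc ⟨j, rfl⟩ hab).1 hcr
      obtain rfl : i = j := by simpa using hall _ (isMatchingInto_refl φ)
      refine ⟨i, ?_, rfl⟩
      by_contra hi
      simp only [Set.mem_ofPred_eq, not_le] at hi
      -- If `i < q`, another index `j < q` exists, and swapping the two gives a perfect matching
      -- without the edge at hand.
      obtain ⟨j, hj, hji⟩ : ∃ j : Fin p, j.val < q ∧ j ≠ i := by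
        by_contra! hno
        have hq1 : q = 1 := by
          by_contra hq1
          have h0 := hno ⟨0, by omega⟩ hq
          have h1 := hno ⟨1, by omega⟩ (by simp; omega)
          simpa [Fin.ext_iff] using h0.trans h1.symm
        subst hq1
        obtain ⟨r, rfl⟩ : ∃ r, p = r + 1 := ⟨p - 1, by omega⟩
        obtain rfl : i = 0 := by ext; simpa using hi
        exact inr_zero_notMem_core φ ha
      have hσ := hall _ (isMatchingInto_of_perm φ (Equiv.swap i j) fun k => by
        by_cases hki : k = i
        · exact Or.inr (by rw [hki, Equiv.swap_apply_left]; exact hj)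
        by_cases hkj : k = j
        · exact Or.inr (by rw [hkj, Equiv.swap_apply_right]; exact hi)
        · exact Or.inl (Equiv.swap_apply_of_ne_of_ne hki hkj))
      exact hji (by simpa using hσ)
    · rintro ⟨j, hj, rfl⟩
      simp only [Set.mem_ofPred_eq] at hj
      have hadj : G.Adj (φ (Sum.inr j)) (φ (Sum.inl j)) :=
        (cliqueFamily_iso_adj φ _ _).2 (Or.inl rfl)
      have hcore : φ (Sum.inr j) ∈ G.core :=
        inr_mem_core φ (j' := ⟨0, by omega⟩) hq (by rw [Ne, Fin.ext_iff]; simp; omega)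
      refine ⟨⟨_, hcore, _, ⟨_, hcore, hadj⟩, hadj, rfl⟩, ?_⟩
      refine (isMuCriticalEdge_iff hG hS hc ⟨j, rfl⟩ hadj).2 fun f hf => ?_
      -- Every matching of the clique into the independent side is perfect, so it covers `b_j`.
      have himg := hf.image_compl_diff_nbhd hS (isCriticalIndepSet_empty_of_cliqueFamily_iso φ)
        (Set.empty_subset _)
      have hjS : φ (Sum.inr j) ∈ (Set.range fun j => φ (Sum.inr j)) \ ∅ :=
        ⟨⟨j, rfl⟩, Set.notMem_empty _⟩
      rw [← himg] at hjS
      obtain ⟨y, ⟨hy, -⟩, hyj⟩ := hjS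
      obtain ⟨i, rfl⟩ : y ∈ Set.range fun i => φ (Sum.inl i) := compl_range_inr φ ▸ hy
      have hij := hf.adj _ hy
      rw [hyj] at hij
      rcases (cliqueFamily_iso_adj φ _ _).1 hij with rfl | h
      · exact hyj
      · omega
  have hinj : Function.Injective fun j => s(φ (Sum.inr j), φ (Sum.inl j)) := by
    intro i j h
    simpa using h
  rw [numMuCriticalCoreEdges, hset, Set.ncard_image_of_injective _ hinj]
  have h1 : {j : Fin p | q ≤ j.val}ᶜ = Set.range (Fin.castLE hqp) := by
    ext j
    simp [Fin.range_castLE]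
  have h2 := Set.ncard_add_ncard_compl {j : Fin p | q ≤ j.val}
  rw [h1, Set.ncard_range_of_injective (Fin.castLE_injective hqp), Nat.card_fin, Nat.card_fin] at h2
  omega

end CliqueFamilyCount

end SimpleGraph

open SimpleGraph in
theorem mainTheorem8 :
    -- Possible values, and the identification of the count with `m(G) - ϱₑ(G)`.
    (∀ (V : Type*) [Finite V] (G : SimpleGraph V), G.IsKonigEgervary →
      G.numMuCriticalCoreEdges + G.rhoE = G.edgeSet.ncard ∧
      (G.eps + 2 ≤ G.xi →
        G.numMuCriticalCoreEdges = G.xi - G.eps ∨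
        G.numMuCriticalCoreEdges ≤ G.xi - G.eps - 2)) ∧
    -- Every such value occurs.
    (∀ d t : ℕ, 2 ≤ d → (t = d ∨ t ≤ d - 2) →
      ∃ (n : ℕ) (G : SimpleGraph (Fin n)), G.IsKonigEgervary ∧
        G.xi = G.eps + d ∧ G.numMuCriticalCoreEdges = t) ∧
    -- The values `0, …, d - 2` occur for the graphs `G_p^q` with `p = d` and `q = d - t`.
    (∀ p q : ℕ, 2 ≤ q → q ≤ p →
      (SimpleGraph.cliqueFamily p q).IsKonigEgervary ∧
      (SimpleGraph.cliqueFamily p q).xi = p ∧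
      (SimpleGraph.cliqueFamily p q).eps = 0 ∧
      (SimpleGraph.cliqueFamily p q).numMuCriticalCoreEdges = p - q) := by
  refine ⟨fun V _ G hG => ⟨numMuCriticalCoreEdges_add_rhoE hG, fun _ => ?_⟩, ?_, ?_⟩
  · have := numMuCriticalCoreEdges_eq_or_le hG
    omega
  · rintro d t hd (rfl | ht)
    · -- The value `t = d` is attained by `G_{d+1}^1`.
      have φ := Iso.map finSumFinEquiv (cliqueFamily (t + 1) 1)
      refine ⟨_, _, isKonigEgervary_of_cliqueFamily_iso φ, ?_, ?_⟩
      · rw [xi_of_cliqueFamily_one_iso φ, eps_of_cliqueFamily_iso φ, zero_add]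
      · rw [numMuCriticalCoreEdges_of_cliqueFamily_iso φ le_rfl (by omega), Nat.add_sub_cancel]
    · have φ := Iso.map finSumFinEquiv (cliqueFamily d (d - t))
      refine ⟨_, _, isKonigEgervary_of_cliqueFamily_iso φ, ?_, ?_⟩
      · rw [xi_of_cliqueFamily_iso φ (by omega) (by omega), eps_of_cliqueFamily_iso φ, zero_add]
      · rw [numMuCriticalCoreEdges_of_cliqueFamily_iso φ (by omega) (by omega)]
        omega
  · intro p q hq hqp
    have φ : cliqueFamily p q ≃g cliqueFamily p q := Iso.refl
    exact ⟨isKonigEgervary_of_cliqueFamily_iso φ, xi_of_cliqueFamily_iso φ hq hqp,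
      eps_of_cliqueFamily_iso φ, numMuCriticalCoreEdges_of_cliqueFamily_iso φ (by omega) hqp⟩
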